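/- Let $\Sigma$ be a finite alphabet. A subset of $\mathbb{N}^d$ is linear if it is of the form $\bar c + P^*$ with $\bar c\in\mathbb{N}^d$ and $P^*$ the additive submonoid generated by a finite set $P\subseteq\mathbb{N}^d$; it is semilinear if it is a finite union of linear sets. A Parikh automaton (PA) over $\Sigma$ is a pair $(A,C)$ for which there are an integer $d>0$ and a finite set $D\subseteq\mathbb{N}^d$ such that $A$ is a (nondeterministic, $\varepsilon$-free) finite automaton over the alphabet $\Sigma\times D$ with one initial state, and $C\subseteq\mathbb{N}^d$ is semilinear. Its language is $$L(A,C)=\{a_1\cdots a_m \in\Sigma^* \mid \text{there are } \bar v_1,\dots,\bar v_m\in D \text{ with } (a_1,\bar v_1)\cdots(a_m,\bar v_m)\in L(A) \text{ and } \bar v_1+\dots+\bar v_m\in C\}.$$ A socle of a language $L\subseteq\Sigma^*$ is a sequence $w_1,\dots,w_n$ of nonempty words over $\Sigma$ with $n>0$ and $L\subseteq w_1^*\cdots w_n^*$; $L$ is bounded if it has a socle. Let $\mathcal{L}_{\mathrm{BoundedPA}}$ be the class of bounded languages over $\Sigma$ that are the language of some PA. Let $\mathrm{BSL}$ be the class of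 languages $L\subseteq\Sigma^*$ that have a socle $w_1,\dots,w_n$ for which the iteration set $$\{(i_1,\dots,i_n)\in\mathbb{N}^n \mid w_1^{i_1}\cdots w_n^{i_n}\in L\}$$ is semilinear. Theorem. $\mathcal{L}_{\mathrm{BoundedPA}}=\mathrm{BSL}$. -/

import Mathlib

/-- A Parikh automaton `(A, C)` of dimension `d` over `α × D`, with state type `σ`: `D` is a finite
set of vectors of `ℕ ^ d`, `A` is an automaton over the alphabet `α × D` with a single initial
state, and `C` is a semilinear subset of `ℕ ^ d`. (Finiteness of `α` and `σ` and `0 < d` are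
imposed where the recognized languages are defined.) -/
structure ParikhAutomaton (α : Type*) (d : ℕ) (σ : Type*) where
  /-- The finite set of vectors that may label transitions. -/
  D : Finset (Fin d → ℕ)
  /-- The underlying automaton `A`. -/
  aut : NFA (α × D) σ
  /-- The automaton has exactly one initial state. -/
  start_eq_singleton : ∃ q₀, aut.start = {q₀}
  /-- The constraint set `C`. -/
  C : Set (Fin d → ℕ)
  /-- The constraint set is semilinear. -/
  isSemilinearSet_C : IsSemilinearSet C

namespace ParikhAutomaton

/-- The projection on `α` of a word over `α × D`. -/
def proj {α : Type*} {d : ℕ} {D : Finset (Fin d → ℕ)} (ω : List (α × D)) : List α :=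
  ω.map Prod.fst

/-- The extended Parikh image of a word over `α × D`: the sum of its vectors. -/
def extParikh {α : Type*} {d : ℕ} {D : Finset (Fin d → ℕ)} (ω : List (α × D)) : Fin d → ℕ :=
  (ω.map fun l => (l.2 : Fin d → ℕ)).sum

/-- The language `L(A, C)`: the projections of the words accepted by `A` whose extended Parikh image
lies in `C`. -/
def language {α : Type*} {d : ℕ} {σ : Type*} (P : ParikhAutomaton α d σ) : Language α :=
  {w | ∃ ω ∈ P.aut.accepts, extParikh ω ∈ P.C ∧ proj ω = w}

end ParikhAutomaton

/-- The class of languages over `α` that are recognized by Parikh automata with finitely many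
states, of some positive dimension. -/
def paLanguages (α : Type*) : Set (Language α) :=
  {L | ∃ d : ℕ, 0 < d ∧ ∃ (σ : Type) (_ : Finite σ) (P : ParikhAutomaton α d σ), P.language = L}

/-- The word `w₁ ^ i₁ ⋯ wₙ ^ iₙ`. -/
def iterWord {α : Type*} {n : ℕ} (w : Fin n → List α) (i : Fin n → ℕ) : List α :=
  (List.ofFn fun k => (List.replicate (i k) (w k)).flatten).flatten

/-- `w₁, …, wₙ` is a socle of `L`: `n > 0`, the words are nonempty, and `L ⊆ w₁* ⋯ wₙ*`. -/
def IsSocle {α : Type*} {n : ℕ} (w : Fin n → List α) (L : Language α) : Prop :=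
  0 < n ∧ (∀ k, w k ≠ []) ∧ ∀ x ∈ L, ∃ i : Fin n → ℕ, x = iterWord w i

/-- The iteration set of `L` with respect to `w₁, …, wₙ`. -/
def iterationSet {α : Type*} {n : ℕ} (w : Fin n → List α) (L : Language α) : Set (Fin n → ℕ) :=
  {i | iterWord w i ∈ L}

/-- The class of bounded languages over `α`. -/
def boundedLanguages (α : Type*) : Set (Language α) :=
  {L | ∃ (n : ℕ) (w : Fin n → List α), IsSocle w L}

/-- The class of bounded languages over `α` that are recognized by Parikh automata. -/
def boundedPALanguages (α : Type*) : Set (Language α) :=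
  paLanguages α ∩ boundedLanguages α

/-- The class of bounded semilinear languages over `α`: languages that have a socle with respect to
which the iteration set is semilinear. -/
def boundedSemilinearLanguages (α : Type*) : Set (Language α) :=
  {L | ∃ (n : ℕ) (w : Fin n → List α), IsSocle w L ∧ IsSemilinearSet (iterationSet w L)}

open Set Pointwise ParikhAutomaton

/-! Bounded PA languages are in BSL because, for every socle, the pairs `(i, v)` such that some run
over `iterWord w i` has extended Parikh image `v` form a semilinear set. Inside one block `u*`, a
run is a walk whose edges read one copy of `u` and carry finitely many weights; Kleene's elimination
of intermediate states (`RunIn.setOf_insert`) handles such walks. Blocks are then added up, `v` is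
restricted to `C`, and `i` is projected out. Conversely, an automaton for `w₁* ⋯ wₙ*` that emits a
unit vector at the start of each copy of a block has exponent vectors as its Parikh images. With the
iteration set as constraint it recognizes the language. -/

/-! ### Sums of weights along walks -/

/-- `RunIn T S q q' x`: there is a nonempty walk from `q` to `q'` all of whose intermediate vertices
lie in `S`, and `x` is a sum of weights of its edges, the weights of an edge `(p, r)` being the
elements of `T p r`. -/
inductive RunIn {σ M : Type*} [AddCommMonoid M] (T : σ → σ → Set M) (S : Set σ) :
    σ → σ → M → Prop
  | single {q q' : σ} {x : M} : x ∈ T q q' → RunIn T S q q' x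
  | cons {q r q' : σ} {x y : M} : x ∈ T q r → r ∈ S → RunIn T S r q' y → RunIn T S q q' (x + y)

namespace RunIn

variable {σ M : Type*} [AddCommMonoid M] {T : σ → σ → Set M} {S : Set σ}

theorem mono {S' : Set σ} (h : S ⊆ S') {q q' : σ} {x : M} (hx : RunIn T S q q' x) :
    RunIn T S' q q' x := by
  induction hx with
  | single h₁ => exact .single h₁
  | cons h₁ h₂ _ ih => exact .cons h₁ (h h₂) ih

theorem trans {q r q' : σ} {x y : M} (hx : RunIn T S q r x) (hr : r ∈ S)
    (hy : RunIn T S r q' y) : RunIn T S q q' (x + y) := by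
  induction hx with
  | single h₁ => exact .cons h₁ hr hy
  | cons h₁ h₂ _ ih => rw [add_assoc]; exact .cons h₁ h₂ (ih hr hy)

/-- Kleene's step: a walk is cut at its visits to `s`. Weights commute, so the star of the loops at
`s` is the submonoid they generate. -/
theorem setOf_insert (s : σ) (q q' : σ) :
    {x | RunIn T (insert s S) q q' x} = {x | RunIn T S q q' x} ∪
      ({x | RunIn T S q s x} + (AddSubmonoid.closure {x | RunIn T S s s x} : Set M) +
        {x | RunIn T S s q' x}) := by
  ext x
  constructor
  · intro hx
    induction hx with
    | single h₁ => exact Or.inl (.single h₁)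
    | @cons q r q' x y h₁ h₂ _ ih =>
      rcases ih with ih | ⟨_, ⟨a, ha, b, hb, rfl⟩, c, hc, rfl⟩
      · rcases h₂ with rfl | h₂
        · refine Or.inr ⟨x + 0, ⟨x, .single h₁, 0, zero_mem _, rfl⟩, y, ih, by simp⟩
        · exact Or.inl (.cons h₁ h₂ ih)
      · rcases h₂ with rfl | h₂
        · refine Or.inr ⟨x + (a + b), ⟨x, .single h₁, a + b, ?_, rfl⟩, c, hc, ?_⟩
          · exact add_mem (AddSubmonoid.subset_closure ha) hb
          · simp only [add_assoc]
        · refine Or.inr ⟨(x + a) + b, ⟨x + a, .cons h₁ h₂ ha, b, hb, rfl⟩, c, hc, ?_⟩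
          simp only [add_assoc]
  · have hmono : ∀ {p p' y}, RunIn T S p p' y → RunIn T (insert s S) p p' y :=
      fun h => h.mono (subset_insert _ _)
    have hs : s ∈ insert s S := mem_insert _ _
    rintro (hx | ⟨_, ⟨a, ha, b, hb, rfl⟩, c, hc, rfl⟩)
    · exact hmono hx
    -- The tail `z` is arbitrary, so that the loops making up `b` can be prepended successively.
    · suffices h : ∀ z, RunIn T (insert s S) s q' z → RunIn T (insert s S) s q' (b + z) by
        have := (hmono ha).trans hs (h _ (hmono hc))
        rwa [← add_assoc] at this
      induction hb using AddSubmonoid.closure_induction with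
      | mem b hb => exact fun z hz => (hmono hb).trans hs hz
      | zero => simp
      | add b b' _ _ ih ih' =>
        intro z hz
        rw [add_assoc]
        exact ih _ (ih' _ hz)

theorem isSemilinearSet [Finite σ] (hT : ∀ q q', IsSemilinearSet (T q q')) (S : Set σ)
    (q q' : σ) : IsSemilinearSet {x | RunIn T S q q' x} := by
  induction S, S.toFinite using Set.Finite.induction_on generalizing q q' with
  | empty =>
    convert hT q q' using 1
    ext x
    refine ⟨fun h => ?_, .single⟩
    cases h with
    | single h => exact h
    | cons _ h _ => exact h.elim
  | insert _ _ ih =>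
    rw [setOf_insert]
    exact (ih _ _).union (((ih _ _).add (ih _ _).closure).add (ih _ _))

end RunIn

/-! ### Extended Parikh images of the runs over a word -/

section Weights

variable {α σ : Type*} {d : ℕ} {D : Finset (Fin d → ℕ)}

theorem ParikhAutomaton.extParikh_append (ω ω' : List (α × D)) :
    extParikh (ω ++ ω') = extParikh ω + extParikh ω' := by
  simp [extParikh]

theorem ParikhAutomaton.proj_append (ω ω' : List (α × D)) :
    proj (ω ++ ω') = proj ω ++ proj ω' := by
  simp [proj]

/-- The extended Parikh images of the words over `α × D` that project to `u` and lead from the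
state `q` to the state `q'`. -/
def runWeights (A : NFA (α × D) σ) (u : List α) (q q' : σ) : Set (Fin d → ℕ) :=
  {v | ∃ ω, q' ∈ A.evalFrom {q} ω ∧ proj ω = u ∧ extParikh ω = v}

theorem finite_runWeights [Finite α] (A : NFA (α × D) σ) (u : List α) (q q' : σ) :
    (runWeights A u q q').Finite := by
  refine ((List.finite_length_eq (α × D) u.length).image extParikh).subset ?_
  rintro v ⟨ω, -, rfl, rfl⟩
  exact ⟨ω, by simp [proj], rfl⟩

theorem mem_runWeights_nil (A : NFA (α × D) σ) {q q' : σ} {v : Fin d → ℕ} :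
    v ∈ runWeights A [] q q' ↔ q' = q ∧ v = 0 := by
  constructor
  · rintro ⟨ω, h, hω, rfl⟩
    obtain rfl : ω = [] := by simpa [proj] using hω
    exact ⟨by simpa using h, by simp [extParikh]⟩
  · rintro ⟨rfl, rfl⟩
    exact ⟨[], by simp, by simp [proj], by simp [extParikh]⟩

theorem mem_runWeights_append (A : NFA (α × D) σ) {u u' : List α} {q q' : σ} {v : Fin d → ℕ} :
    v ∈ runWeights A (u ++ u') q q' ↔
      ∃ r, ∃ x ∈ runWeights A u q r, ∃ y ∈ runWeights A u' r q', x + y = v := by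
  constructor
  · rintro ⟨ω, h, hω, rfl⟩
    obtain ⟨ω₁, ω₂, rfl, rfl, rfl⟩ := List.map_eq_append_iff.1 hω
    rw [NFA.evalFrom_append, NFA.mem_evalFrom_iff_exists] at h
    obtain ⟨r, h₁, h₂⟩ := h
    exact ⟨r, _, ⟨ω₁, h₁, rfl, rfl⟩, _, ⟨ω₂, h₂, rfl, rfl⟩, (extParikh_append _ _).symm⟩
  · rintro ⟨r, _, ⟨ω₁, h₁, rfl, rfl⟩, _, ⟨ω₂, h₂, rfl, rfl⟩, rfl⟩
    refine ⟨ω₁ ++ ω₂, ?_, proj_append _ _, extParikh_append _ _⟩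
    rw [NFA.evalFrom_append, NFA.mem_evalFrom_iff_exists]
    exact ⟨r, h₁, h₂⟩

/-- A run over a power of `u` is cut between copies; the first coordinate of the weights counts
them. The empty walk is separate because `RunIn` has at least one edge. -/
theorem runWeights_pow_iff_runIn (A : NFA (α × D) σ) (u : List α) (q q' : σ)
    (x : ℕ × (Fin d → ℕ)) :
    x.2 ∈ runWeights A (List.replicate x.1 u).flatten q q' ↔
      (q' = q ∧ x = 0) ∨
        RunIn (fun p r => {1} ×ˢ runWeights A u p r) univ q q' x := by
  constructor
  · obtain ⟨i, v⟩ := x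
    induction i generalizing q v with
    | zero =>
      intro h
      obtain ⟨rfl, rfl⟩ := (mem_runWeights_nil A).1 (by simpa using h)
      exact Or.inl ⟨rfl, rfl⟩
    | succ i ih =>
      intro h
      simp only [List.replicate_succ, List.flatten_cons] at h
      obtain ⟨r, x, hx, y, hy, rfl⟩ := (mem_runWeights_append A).1 h
      right
      have hx' : ((1, x) : ℕ × (Fin d → ℕ)) ∈ ({1} : Set ℕ) ×ˢ runWeights A u q r := ⟨rfl, hx⟩
      rcases ih r y hy with ⟨rfl, h⟩ | h
      · obtain ⟨rfl, rfl⟩ := Prod.mk.inj h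
        simpa using RunIn.single (T := fun p r => ({1} : Set ℕ) ×ˢ runWeights A u p r) hx'
      · have := RunIn.cons (T := fun p r => ({1} : Set ℕ) ×ˢ runWeights A u p r) hx'
          (mem_univ r) h
        simpa [add_comm] using this
  · rintro (⟨rfl, rfl⟩ | h)
    · simpa using (mem_runWeights_nil A).2 ⟨rfl, rfl⟩
    · induction h with
      | @single q q' x h =>
        have h1 : x.1 = 1 := h.1
        simpa [h1] using h.2
      | @cons q r q' x y h _ _ ih =>
        have h1 : x.1 = 1 := h.1
        simp only [Prod.fst_add, Prod.snd_add, h1, Nat.add_comm 1, List.replicate_succ,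
          List.flatten_cons]
        exact (mem_runWeights_append A).2 ⟨r, _, h.2, _, ih, rfl⟩

theorem isSemilinearSet_runWeights_pow [Finite α] [Finite σ] (A : NFA (α × D) σ) (u : List α)
    (q q' : σ) :
    IsSemilinearSet
      {x : ℕ × (Fin d → ℕ) | x.2 ∈ runWeights A (List.replicate x.1 u).flatten q q'} := by
  simp_rw [runWeights_pow_iff_runIn]
  refine IsSemilinearSet.union (.of_finite ((finite_singleton 0).subset fun x hx => hx.2)) ?_
  exact RunIn.isSemilinearSet
    (fun p r => .of_finite ((finite_singleton 1).prod (finite_runWeights A u p r))) univ q q'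

theorem iterWord_succ {n : ℕ} (w : Fin (n + 1) → List α) (i : Fin (n + 1) → ℕ) :
    iterWord w i =
      (List.replicate (i 0) (w 0)).flatten ++ iterWord (fun k => w k.succ) (fun k => i k.succ) := by
  simp [iterWord, List.ofFn_succ]

theorem isSemilinearSet_runWeights_iterWord [Finite α] [Finite σ] (A : NFA (α × D) σ) {n : ℕ}
    (w : Fin n → List α) (q q' : σ) :
    IsSemilinearSet
      {x : (Fin n → ℕ) × (Fin d → ℕ) | x.2 ∈ runWeights A (iterWord w x.1) q q'} := by
  induction n generalizing q with
  | zero =>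
    refine .of_finite (((finite_univ (α := Fin 0 → ℕ)).prod
      (finite_runWeights A [] q q')).subset fun x hx => ⟨mem_univ _, ?_⟩)
    simpa [iterWord] using hx
  | succ n ih =>
    -- `f` and `g` fill disjoint coordinates of the exponent vector but share the Parikh vector, so
    -- adding their images concatenates runs.
    let f : ℕ × (Fin d → ℕ) →+ (Fin (n + 1) → ℕ) × (Fin d → ℕ) :=
      { toFun := fun x => (Fin.cons x.1 0, x.2)
        map_zero' := by
          ext k <;> [refine Fin.cases ?_ (fun k => ?_) k; skip] <;> simp
        map_add' := fun x y => by
          ext k <;> [refine Fin.cases ?_ (fun k => ?_) k; skip] <;> simp }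
    let g : (Fin n → ℕ) × (Fin d → ℕ) →+ (Fin (n + 1) → ℕ) × (Fin d → ℕ) :=
      { toFun := fun x => (Fin.cons 0 x.1, x.2)
        map_zero' := by
          ext k <;> [refine Fin.cases ?_ (fun k => ?_) k; skip] <;> simp
        map_add' := fun x y => by
          ext k <;> [refine Fin.cases ?_ (fun k => ?_) k; skip] <;> simp }
    have key : {x : (Fin (n + 1) → ℕ) × (Fin d → ℕ) |
        x.2 ∈ runWeights A (iterWord w x.1) q q'} = ⋃ r,
        f '' {x | x.2 ∈ runWeights A (List.replicate x.1 (w 0)).flatten q r} +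
        g '' {x | x.2 ∈ runWeights A (iterWord (fun k => w k.succ) x.1) r q'} := by
      ext ⟨i, v⟩
      simp only [mem_ofPred_eq, iterWord_succ, mem_runWeights_append, mem_iUnion]
      refine exists_congr fun r => ?_
      constructor
      · rintro ⟨x, hx, y, hy, rfl⟩
        refine ⟨_, ⟨(i 0, x), hx, rfl⟩, _, ⟨(fun k => i k.succ, y), hy, rfl⟩, ?_⟩
        refine Prod.ext (funext fun k => ?_) rfl
        refine Fin.cases ?_ (fun k => ?_) k <;> simp [f, g]
      · rintro ⟨_, ⟨x, hx, rfl⟩, _, ⟨y, hy, rfl⟩, h⟩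
        obtain ⟨rfl, rfl⟩ := Prod.mk.inj h
        exact ⟨x.2, by simpa [f, g] using hx, y.2, by simpa [f, g] using hy, rfl⟩
    rw [key]
    exact .iUnion fun r =>
      ((isSemilinearSet_runWeights_pow A (w 0) q r).image f).add ((ih _ r).image g)

/-- The iteration sets of the language of a Parikh automaton are semilinear. -/
theorem ParikhAutomaton.isSemilinearSet_iterationSet [Finite α] [Finite σ]
    (P : ParikhAutomaton α d σ) {n : ℕ} (w : Fin n → List α) :
    IsSemilinearSet (iterationSet w P.language) := by
  obtain ⟨q₀, hq₀⟩ := P.start_eq_singleton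
  have key : iterationSet w P.language = AddMonoidHom.fst (Fin n → ℕ) (Fin d → ℕ) ''
      ((⋃ q ∈ P.aut.accept, {x | x.2 ∈ runWeights P.aut (iterWord w x.1) q₀ q}) ∩
        AddMonoidHom.snd (Fin n → ℕ) (Fin d → ℕ) ⁻¹' P.C) := by
    ext i
    constructor
    · rintro ⟨ω, ⟨q, hq, hω⟩, hC, hp⟩
      refine ⟨(i, extParikh ω), ⟨mem_biUnion hq ⟨ω, ?_, hp, rfl⟩, hC⟩, rfl⟩
      rwa [NFA.eval, hq₀] at hω
    · rintro ⟨⟨i, v⟩, ⟨hx, hC⟩, rfl⟩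
      simp only [mem_iUnion] at hx
      obtain ⟨q, hq, ω, hω, hp, rfl⟩ := hx
      refine ⟨ω, ⟨q, hq, ?_⟩, hC, hp⟩
      rwa [NFA.eval, hq₀]
  rw [key]
  exact ((IsSemilinearSet.biUnion (Set.toFinite _) fun q _ =>
    isSemilinearSet_runWeights_iterWord P.aut w q₀ q).inter
      (P.isSemilinearSet_C.preimage _)).image _

end Weights

/-! ### A Parikh automaton for a bounded semilinear language -/

theorem iterWord_zero {α : Type*} {n : ℕ} (w : Fin n → List α) : iterWord w 0 = [] := by
  simp [iterWord]

theorem iterWord_add_single {α : Type*} {n : ℕ} (w : Fin n → List α) (i : Fin n → ℕ) (k : Fin n)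
    (h : ∀ j, k < j → i j = 0) : iterWord w (i + Pi.single k 1) = iterWord w i ++ w k := by
  induction n with
  | zero => exact k.elim0
  | succ n ih =>
    rw [iterWord_succ, iterWord_succ]
    refine Fin.cases (fun h => ?_) (fun k h => ?_) k h
    · have h0 : (fun k : Fin n => i k.succ) = 0 := funext fun k => h _ (Fin.succ_pos k)
      have h1 : (fun k : Fin n => (i + Pi.single 0 1 : Fin (n + 1) → ℕ) k.succ) = 0 :=
        funext fun k => by simp [h _ (Fin.succ_pos k)]
      rw [h0, h1, iterWord_zero]
      simp [List.replicate_succ']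
    · have h1 : (fun j : Fin n => (i + Pi.single k.succ 1 : Fin (n + 1) → ℕ) j.succ) =
          (fun j => i j.succ) + Pi.single k 1 := by
        funext j
        simp [Pi.single_apply]
      rw [h1, ih _ _ _ fun j hj => h _ (Fin.succ_lt_succ_iff.2 hj)]
      simp [(Fin.succ_ne_zero _).symm]

section Block

variable {α : Type*} {n : ℕ}

/-- The vectors counting at most one occurrence of at most one block. -/
def blockVectors (n : ℕ) : Finset (Fin n → ℕ) :=
  insert 0 (Finset.univ.image fun k => Pi.single k 1)

/-- The states of `blockAutomaton`: in the state `(k, p)`, the first `p` letters of the current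
copy of `w k` have been read. -/
abbrev BlockState (w : Fin n → List α) : Type :=
  Fin n × Fin ((∑ k, (w k).length) + 1)

/-- A state of `blockAutomaton` in which no copy of a word `w k` is partially read. -/
def BlockState.IsComplete {w : Fin n → List α} (s : BlockState w) : Prop :=
  (s.2 : ℕ) = 0 ∨ (s.2 : ℕ) = (w s.1).length

/-- An automaton reading the words of `w₁* ⋯ wₙ*`, which marks the first letter of each copy of
`w k` by the unit vector `Pi.single k 1`, and all other letters by `0`. -/
def blockAutomaton (w : Fin n → List α) (hn : 0 < n) :
    NFA (α × blockVectors n) (BlockState w) where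
  step s l := {t |
    -- Requiring a positive position forces the first letter of every copy through the second,
    -- counting case; position `0` occurs only at the start of a run.
    (t.1 = s.1 ∧ 0 < (s.2 : ℕ) ∧ (t.2 : ℕ) = s.2 + 1 ∧ (w s.1)[(s.2 : ℕ)]? = some l.1 ∧
      (l.2 : Fin n → ℕ) = 0) ∨
    (s.1 ≤ t.1 ∧ s.IsComplete ∧ (t.2 : ℕ) = 1 ∧ (w t.1)[0]? = some l.1 ∧
      (l.2 : Fin n → ℕ) = Pi.single t.1 1)}
  start := {(⟨0, hn⟩, 0)}
  accept := {s | s.IsComplete}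

/-- A copy is counted at its first letter, so the invariant completes the word read with the rest of
the current copy. At position `0` no copy is open. -/
theorem blockAutomaton_sound (w : Fin n → List α) (hn : 0 < n) (ω : List (α × blockVectors n))
    (t : BlockState w) (ht : t ∈ (blockAutomaton w hn).eval ω) :
    (∀ j, t.1 < j → extParikh ω j = 0) ∧
      proj ω ++ (if (t.2 : ℕ) = 0 then [] else (w t.1).drop t.2) = iterWord w (extParikh ω) := by
  induction ω using List.reverseRecOn generalizing t with
  | nil =>
    obtain rfl : t = (⟨0, hn⟩, 0) := ht
    have h0 : extParikh ([] : List (α × blockVectors n)) = 0 := by simp [extParikh]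
    rw [h0, iterWord_zero]
    simp [proj]
  | append_singleton ω l ih =>
    rw [NFA.eval_append_singleton, NFA.mem_stepSet] at ht
    obtain ⟨s, hs, ht⟩ := ht
    obtain ⟨hsupp, hword⟩ := ih s hs
    have hl : extParikh [l] = l.2 := by simp [extParikh]
    have hp : proj [l] = [l.1] := rfl
    rw [extParikh_append, proj_append, hl, hp]
    rcases ht with ⟨h1, h2, h3, h4, h5⟩ | ⟨h1, h2, h3, h4, h5⟩
    · rw [h5, add_zero, h1, h3]
      refine ⟨hsupp, ?_⟩
      obtain ⟨hlt, hget⟩ := List.getElem?_eq_some_iff.1 h4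
      rw [if_neg h2.ne', List.drop_eq_getElem_cons hlt, hget] at hword
      simpa using hword
    · rw [h5, h3]
      have hsupp' : ∀ j, t.1 < j → extParikh ω j = 0 := fun j hj => hsupp j (h1.trans_lt hj)
      refine ⟨fun j hj => by simp [hsupp' j hj, hj.ne'], ?_⟩
      rw [iterWord_add_single _ _ _ hsupp', ← hword]
      obtain ⟨hlt, hget⟩ := List.getElem?_eq_some_iff.1 h4
      have hdrop : (if (s.2 : ℕ) = 0 then [] else (w s.1).drop s.2) = [] := by
        rcases h2 with h2 | h2 <;> simp [h2]
      have hw : [l.1] ++ (w t.1).drop 1 = w t.1 := by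
        rw [← hget]
        simpa using (List.drop_eq_getElem_cons hlt).symm
      rw [hdrop, List.append_nil, if_neg one_ne_zero, List.append_assoc, hw]

theorem length_le_sum_length (w : Fin n → List α) (k : Fin n) :
    (w k).length ≤ ∑ k, (w k).length :=
  Finset.single_le_sum (f := fun k => (w k).length) (fun _ _ => Nat.zero_le _) (Finset.mem_univ k)

theorem blockAutomaton_read_block (w : Fin n → List α) (hn : 0 < n) {s : BlockState w}
    (hs : s.IsComplete) {k : Fin n} (hk : s.1 ≤ k) {S : Set (BlockState w)} (hsS : s ∈ S) (p : ℕ)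
    (hp : p + 1 ≤ (w k).length) :
    ∃ ω, ∃ t ∈ (blockAutomaton w hn).evalFrom S ω, t.1 = k ∧ (t.2 : ℕ) = p + 1 ∧
      proj ω = (w k).take (p + 1) ∧ extParikh ω = Pi.single k 1 := by
  have hle := length_le_sum_length w k
  induction p with
  | zero =>
    have hlt : 0 < (w k).length := by omega
    refine ⟨[((w k)[0], ⟨Pi.single k 1, by simp [blockVectors]⟩)],
      (k, ⟨1, by omega⟩), ?_, rfl, rfl, ?_, by simp [extParikh]⟩
    · rw [NFA.evalFrom_singleton, NFA.mem_stepSet]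
      exact ⟨s, hsS, Or.inr ⟨hk, hs, rfl, by simp [hlt], rfl⟩⟩
    · rw [List.take_succ_eq_append_getElem hlt]
      simp [proj]
  | succ p ih =>
    obtain ⟨ω, t, ht, rfl, h2, h3, h4⟩ := ih (by omega)
    have hlt : p + 1 < (w t.1).length := by omega
    refine ⟨ω ++ [((w t.1)[p + 1], ⟨0, by simp [blockVectors]⟩)],
      (t.1, ⟨p + 2, by omega⟩), ?_, rfl, rfl, ?_, ?_⟩
    · rw [NFA.evalFrom_append, NFA.evalFrom_singleton, NFA.mem_stepSet]
      exact ⟨t, ht, Or.inl ⟨rfl, by omega, by simp [h2], by simp [h2, hlt], rfl⟩⟩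
    · rw [proj_append, h3, List.take_succ_eq_append_getElem hlt]
      simp [proj]
    · rw [extParikh_append, h4]
      simp [extParikh]

/-- Induction on the number of copies, removing one of the last block `k'` in use. The bound `t.1 ≤
k` ensures that `k'` can still be entered after the shorter run. -/
theorem blockAutomaton_complete (w : Fin n → List α) (hn : 0 < n) (hw : ∀ k, w k ≠ []) (m : ℕ)
    (i : Fin n → ℕ) (hi : ∑ k, i k = m) (k : Fin n) (hk : ∀ j, k < j → i j = 0) :
    ∃ ω, ∃ t ∈ (blockAutomaton w hn).eval ω, t.IsComplete ∧ t.1 ≤ k ∧ extParikh ω = i ∧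
      proj ω = iterWord w i := by
  induction m generalizing i k with
  | zero =>
    obtain rfl : i = 0 := by
      funext j
      simpa using Finset.sum_eq_zero_iff.1 hi j (Finset.mem_univ j)
    refine ⟨[], (⟨0, hn⟩, 0), rfl, Or.inl rfl, Fin.mk_le_of_le_val (Nat.zero_le _),
      by simp [extParikh], ?_⟩
    rw [iterWord_zero]
    rfl
  | succ m ih =>
    have hne : (Finset.univ.filter fun j => i j ≠ 0).Nonempty := by
      by_contra h
      rw [Finset.not_nonempty_iff_eq_empty, Finset.filter_eq_empty_iff] at h
      have : ∑ k, i k = 0 := Finset.sum_eq_zero fun j hj => not_not.1 (h hj)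
      omega
    obtain ⟨k', hk', hmax⟩ := Finset.exists_max_image _ id hne
    have hk0 : i k' ≠ 0 := (Finset.mem_filter.1 hk').2
    have hsupp : ∀ j, k' < j → i j = 0 := fun j hj => by
      by_contra h
      exact absurd (hmax j (by simpa using h)) (not_le.2 hj)
    have hkk' : k' ≤ k := not_lt.1 fun h => hk0 (hk _ h)
    obtain ⟨i', rfl⟩ : ∃ i', i = i' + Pi.single k' 1 := by
      refine ⟨i - Pi.single k' 1, (tsub_add_cancel_of_le fun j => ?_).symm⟩
      rcases eq_or_ne j k' with rfl | hj
      · simpa using Nat.one_le_iff_ne_zero.2 hk0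
      · simp [hj]
    have hsupp' : ∀ j, k' < j → i' j = 0 := fun j hj => by
      have := hsupp j hj
      simp only [Pi.add_apply] at this
      omega
    have hsum : ∑ j, i' j = m := by
      simpa [Finset.sum_add_distrib] using hi
    obtain ⟨ω, t, ht, htc, htk, hω, hp⟩ := ih i' hsum k' hsupp'
    have hlen : 0 < (w k').length := List.length_pos_iff.2 (hw k')
    obtain ⟨ω', t', ht', rfl, h2, h3, h4⟩ := blockAutomaton_read_block w hn htc htk ht
      ((w k').length - 1) (by omega)
    have hl : (w t'.1).length - 1 + 1 = (w t'.1).length := by omega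
    rw [hl] at h2 h3
    refine ⟨ω ++ ω', t', ?_, Or.inr h2, hkk', ?_, ?_⟩
    · rwa [NFA.eval, NFA.evalFrom_append]
    · rw [extParikh_append, hω, h4]
    · rw [proj_append, hp, h3, List.take_length, iterWord_add_single _ _ _ hsupp']

/-- The Parikh automaton that accepts the words `w₁ ^ i₁ ⋯ wₙ ^ iₙ` with `i ∈ I`. -/
def blockParikhAutomaton (w : Fin n → List α) (hn : 0 < n) (I : Set (Fin n → ℕ))
    (hI : IsSemilinearSet I) : ParikhAutomaton α n (BlockState w) where
  D := blockVectors n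
  aut := blockAutomaton w hn
  start_eq_singleton := ⟨_, rfl⟩
  C := I
  isSemilinearSet_C := hI

/-- Decompositions along `w` need not be unique: a word is accepted as soon as one of its exponent
vectors lies in `I`. -/
theorem blockParikhAutomaton_language (w : Fin n → List α) (hn : 0 < n) (hw : ∀ k, w k ≠ [])
    (I : Set (Fin n → ℕ)) (hI : IsSemilinearSet I) :
    (blockParikhAutomaton w hn I hI).language = iterWord w '' I := by
  apply Set.Subset.antisymm
  · rintro x ⟨ω, ⟨t, htc, ht⟩, hC, rfl⟩
    refine ⟨_, hC, ?_⟩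
    have hdrop : (if (t.2 : ℕ) = 0 then [] else (w t.1).drop t.2) = [] := by
      rcases htc with h | h <;> simp [h]
    have := (blockAutomaton_sound w hn ω t ht).2
    rw [hdrop, List.append_nil] at this
    exact this.symm
  · rintro _ ⟨i, hi, rfl⟩
    -- For the last index `n - 1` the vanishing condition is vacuous.
    obtain ⟨ω, t, ht, htc, -, rfl, hp⟩ := blockAutomaton_complete w hn hw _ i rfl
      ⟨n - 1, by omega⟩ fun j hj => by
        have := j.isLt
        simp only [Fin.lt_def] at hj
        omega
    exact ⟨ω, ⟨t, htc, ht⟩, hi, hp⟩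

end Block

theorem IsSocle.image_iterationSet {α : Type*} {n : ℕ} {w : Fin n → List α} {L : Language α}
    (h : IsSocle w L) : iterWord w '' iterationSet w L = L := by
  apply Set.Subset.antisymm
  · rintro _ ⟨i, hi, rfl⟩
    exact hi
  · intro x hx
    obtain ⟨i, rfl⟩ := h.2.2 x hx
    exact ⟨i, hx, rfl⟩

theorem theorem2 (α : Type*) [Finite α] :
    boundedPALanguages α = boundedSemilinearLanguages α := by
  ext L
  constructor
  · rintro ⟨⟨d, -, σ, _, P, rfl⟩, n, w, hw⟩
    exact ⟨n, w, hw, P.isSemilinearSet_iterationSet w⟩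
  · rintro ⟨n, w, hw, hI⟩
    refine ⟨⟨n, hw.1, BlockState w, inferInstance, blockParikhAutomaton w hw.1 _ hI, ?_⟩, n, w, hw⟩
    rw [blockParikhAutomaton_language w hw.1 hw.2.1]
    exact hw.image_iterationSet
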